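/- **Proposition (Uniform consistency under equivalent shrinking condition).** Let $(X_1,Y_1),(X_2,Y_2),\dots$ be i.i.d. random vectors with $X_i\in\mathbb R^d$ and $Y_i\in\mathbb R$ on a probability space $(\Omega,\mathcal F,\mathbb P)$, and let $\theta$ be a random element of some measurable space that is independent of $(X_i,Y_i)_{i\ge 1}$. Write $X_i^j$ for the $j$-th coordinate of $X_i$. *Assumption 1 (covariates).* $X_1\in[0,1]^d$ almost surely, $X_1$ has a continuous density $f$ on $[0,1]^d$ with $0<\varepsilon\le f\le C<\infty$, $\mathbb E[Y_1^2]<\infty$, and $x\mapsto \mathbb E[Y_1^2\mid X_1=x]$ is continuous on $[0,1]^d$ and bounded by a constant $K$. *Assumption 2 (honesty).* For every $n$ the index set $\{1,\dots,n\}$ is partitioned deterministically into two sets $\mathcal I=\mathcal I_n$ and $\mathcal J=\mathcal J_n$ with $n_{\mathcal I}:=|\mathcal I|=\Theta(n)$ and $n_{\mathcal J}:=|\mathcal J|=\Theta(n)$ as $n\to\infty$. A finite binary tree with root node $(0,1]^d$ is grown as a function of $\theta$ and the data $(X_i,Y_i)_{i\in\mathcal J}$ only. Each split of a node is on a single coordinate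 $j$ at a threshold $c$ in the $j$-th interval of that node, and sends a point $x$ to the left daughter if $x^j\le c$ and to the right daughter otherwise. For $x\in[0,1]^d$, let $\prod_{j=1}^d (a^x_{n,j},b^x_{n,j}]$ be the leaf into which $x$ falls when it is sent through the tree by these rules, and let $$N_L^j(x,\theta)=\sum_{i\in\mathcal I}\mathbf 1_{\{X_i^j\in(a^x_{n,j},\,b^x_{n,j}]\}} .$$ Under these assumptions, as $n\to\infty$, $$\sup_{x\in[0,1]^d}\{b^x_{n,j}-a^x_{n,j}\}\ \xrightarrow{\ \mathbb P\ }\ 0\quad\text{for all } j=1,\dots,d$$ if and only if $$\frac{\sup_{x\in[0,1]^d}N_L^j(x,\theta)}{n_{\mathcal I}}\ \xrightarrow{\ \mathbb P\ }\ 0\quad\text{for all } j=1,\dots,d .$$ The same equivalence holds with convergence in probability replaced by almost sure convergence in both statements. -/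

import Mathlib

open MeasureTheory ProbabilityTheory Filter Asymptotics

/-- Finite binary decision trees on `ℝ^d` with splits on single features: an observation `x` goes to
the left daughter of `split j c left right` if `x j ≤ c`, and to the right daughter otherwise. -/
inductive SplitTree (d : ℕ) : Type
  | leaf : SplitTree d
  | split (j : Fin d) (c : ℝ) (left right : SplitTree d) : SplitTree d

namespace SplitTree

variable {d : ℕ}

/-- Every split of a tree grown from the node `∏ⱼ (a j, b j]` uses a threshold in the interval of
the current node along the split coordinate. -/
def IsValid : SplitTree d → (Fin d → ℝ) → (Fin d → ℝ) → Prop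
  | leaf, _, _ => True
  | split j c left right, a, b =>
      c ∈ Set.Ioc (a j) (b j) ∧
        left.IsValid a (Function.update b j c) ∧ right.IsValid (Function.update a j c) b

/-- Endpoints of the leaf into which `x` falls, when the tree is grown from `∏ⱼ (a j, b j]`. -/
noncomputable def leafBounds :
    SplitTree d → (Fin d → ℝ) → (Fin d → ℝ) → (Fin d → ℝ) → (Fin d → ℝ) × (Fin d → ℝ)
  | leaf, a, b, _ => (a, b)
  | split j c left right, a, b, x =>
      if x j ≤ c then left.leafBounds a (Function.update b j c) x
      else right.leafBounds (Function.update a j c) b x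

/-- Left endpoint along coordinate `j` of the leaf of `x`; the root node is the unit cube, with
`j`-th interval `(0, 1]`. A point `x` with some coordinate `0` is sent to its leaf by the splits. -/
noncomputable def lower (t : SplitTree d) (x : Fin d → ℝ) (j : Fin d) : ℝ :=
  (t.leafBounds 0 1 x).1 j

/-- Right endpoint along coordinate `j` of the leaf of `x`. -/
noncomputable def upper (t : SplitTree d) (x : Fin d → ℝ) (j : Fin d) : ℝ :=
  (t.leafBounds 0 1 x).2 j

end SplitTree

/-- `(X 0, Y 0), (X 1, Y 1), …` are independent and identically distributed. -/
structure IsIIDSample {Ω : Type*} [MeasurableSpace Ω] (P : Measure Ω) {d : ℕ}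
    (X : ℕ → Ω → Fin d → ℝ) (Y : ℕ → Ω → ℝ) : Prop where
  measurable_X : ∀ i, Measurable (X i)
  measurable_Y : ∀ i, Measurable (Y i)
  indep : iIndepFun (fun i ω => (X i ω, Y i ω)) P
  ident : ∀ i, IdentDistrib (fun ω => (X i ω, Y i ω)) (fun ω => (X 0 ω, Y 0 ω)) P P

/-- Assumption on the generic observation `(X, Y)`: `X` has a continuous density on `[0, 1]^d`
bounded away from zero and infinity, `Y` is square integrable, and the conditional second moment
`E[Y² | X = x]` is continuous and bounded on `[0, 1]^d`. -/
structure CovariateAssumption {Ω : Type*} [MeasurableSpace Ω] (P : Measure Ω) {d : ℕ}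
    (X : Ω → Fin d → ℝ) (Y : Ω → ℝ) : Prop where
  density : ∃ f : (Fin d → ℝ) → ℝ, ContinuousOn f (Set.Icc 0 1) ∧
    (∃ ε C : ℝ, 0 < ε ∧ ∀ x ∈ Set.Icc (0 : Fin d → ℝ) 1, ε ≤ f x ∧ f x ≤ C) ∧
    P.map X = (volume.restrict (Set.Icc 0 1)).withDensity (fun x => ENNReal.ofReal (f x))
  sq_integrable : MemLp Y 2 P
  cond_moment : ∃ g : (Fin d → ℝ) → ℝ, ContinuousOn g (Set.Icc 0 1) ∧
    (∃ K : ℝ, ∀ x ∈ Set.Icc (0 : Fin d → ℝ) 1, g x ≤ K) ∧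
    P[fun ω => Y ω ^ 2 | MeasurableSpace.comap X inferInstance] =ᵐ[P] fun ω => g (X ω)

/-- An honest tree-growing procedure with auxiliary parameter in `Par`. For each sample size `n` the
observations with index `< n` are partitioned into the prediction data `I n` and the splitting data
`J n`, both of (deterministic) size `Θ(n)`, and the tree is a function of the auxiliary parameter and
the observations in `J n` only. -/
structure HonestTree (d : ℕ) (Par : Type*) where
  I : ℕ → Finset ℕ
  J : ℕ → Finset ℕ
  disjoint : ∀ n, Disjoint (I n) (J n)
  union_eq : ∀ n, I n ∪ J n = Finset.range n
  card_I : (fun n => ((I n).card : ℝ)) =Θ[atTop] (fun n => (n : ℝ))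
  card_J : (fun n => ((J n).card : ℝ)) =Θ[atTop] (fun n => (n : ℝ))
  grow : (n : ℕ) → Par → (J n → (Fin d → ℝ) × ℝ) → SplitTree d
  valid : ∀ n p z, (grow n p z).IsValid 0 1

namespace HonestTree

variable {d : ℕ} {Par Ω : Type*}

/-- The tree grown from the first `n` observations and the parameter `θ`. -/
def tree (T : HonestTree d Par) (θ : Ω → Par) (X : ℕ → Ω → Fin d → ℝ) (Y : ℕ → Ω → ℝ)
    (n : ℕ) (ω : Ω) : SplitTree d :=
  T.grow n (θ ω) (fun i => (X i ω, Y i ω))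

/-- The supremum over `x ∈ [0, 1]^d` of the `j`-th side length of the leaf of `x`. -/
noncomputable def supSide (T : HonestTree d Par) (θ : Ω → Par) (X : ℕ → Ω → Fin d → ℝ)
    (Y : ℕ → Ω → ℝ) (j : Fin d) (n : ℕ) (ω : Ω) : ℝ :=
  ⨆ x : Set.Icc (0 : Fin d → ℝ) 1, ((T.tree θ X Y n ω).upper x j - (T.tree θ X Y n ω).lower x j)

/-- The number of prediction observations whose `j`-th coordinate lies in the `j`-th interval of the
leaf of `x`. -/
noncomputable def count (T : HonestTree d Par) (θ : Ω → Par) (X : ℕ → Ω → Fin d → ℝ)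
    (Y : ℕ → Ω → ℝ) (j : Fin d) (n : ℕ) (x : Fin d → ℝ) (ω : Ω) : ℝ :=
  ∑ i ∈ T.I n, Set.indicator
    (Set.Ioc ((T.tree θ X Y n ω).lower x j) ((T.tree θ X Y n ω).upper x j)) 1 (X i ω j)

/-- The supremum of `count` over `x ∈ [0, 1]^d`, divided by the number of prediction observations. -/
noncomputable def supProportion (T : HonestTree d Par) (θ : Ω → Par) (X : ℕ → Ω → Fin d → ℝ)
    (Y : ℕ → Ω → ℝ) (j : Fin d) (n : ℕ) (ω : Ω) : ℝ :=
  (⨆ x : Set.Icc (0 : Fin d → ℝ) 1, T.count θ X Y j n x ω) / ((T.I n).card : ℝ)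

end HonestTree

/-! The leaf intervals are random, but they can be compared with the fixed grid cells `(i/k,
(i+2)/k]`. A subinterval of `[0, 1]` of length at most `1/k` lies in one cell, and one of length at
least `3/k` contains a cell inside `[0, 1]` (`exists_Ioc_subset_grid`, `exists_grid_subset_Ioc`). By
the density bounds, a cell has probability at most `2C/k`, and at least `2ε/k` if it lies in `[0,
1]`. By the law of large numbers, almost surely all cell frequencies are eventually within `τ` of
these probabilities. On that event short sides force small proportions and small proportions force
short sides, whatever the tree is. `tendsto_zero_of_ae_eventually_control` turns this into both
modes of convergence. -/

theorem SplitTree.leafBounds_mem {d : ℕ} (t : SplitTree d) (a b x : Fin d → ℝ) (hab : a ≤ b)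
    (ht : t.IsValid a b) (j : Fin d) :
    a j ≤ (t.leafBounds a b x).1 j ∧ (t.leafBounds a b x).1 j ≤ (t.leafBounds a b x).2 j ∧
      (t.leafBounds a b x).2 j ≤ b j := by
  induction t generalizing a b with
  | leaf => exact ⟨le_rfl, hab j, le_rfl⟩
  | split i c left right ihl ihr =>
    -- The threshold may equal `b i`, making the right daughter degenerate; hence only weak
    -- inequalities survive the induction.
    obtain ⟨⟨hac, hcb⟩, hl, hr⟩ := ht
    have hb : Function.update b i c ≤ b := update_le_self_iff.2 hcb
    have ha : a ≤ Function.update a i c := le_update_self_iff.2 hac.le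
    rw [leafBounds]
    split_ifs
    · obtain ⟨h₁, h₂, h₃⟩ := ihl a _ (le_update_iff.2 ⟨hac.le, fun k _ => hab k⟩) hl
      exact ⟨h₁, h₂, h₃.trans (hb j)⟩
    · obtain ⟨h₁, h₂, h₃⟩ := ihr _ b (update_le_iff.2 ⟨hcb, fun k _ => hab k⟩) hr
      exact ⟨(ha j).trans h₁, h₂, h₃⟩

/-! ### Comparison of intervals with a fixed grid. -/

theorem exists_Ioc_subset_grid {l u : ℝ} {k : ℕ} (hk : 0 < k) (hl : 0 ≤ l) (hlu : l ≤ u)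
    (hu : u ≤ 1) (h : u - l ≤ 1 / k) :
    ∃ i ≤ k, Set.Ioc l u ⊆ Set.Ioc ((i : ℝ) / k) ((i + 2) / k) := by
  have hk' : (0 : ℝ) < k := Nat.cast_pos.2 hk
  -- Rounding `l` down loses less than `1/k`, so cells of length `2/k` suffice. The index can be `k
  -- - 1` or `k`, in which case the cell sticks out beyond `1`.
  refine ⟨⌊l * k⌋₊, Nat.floor_le_of_le ?_, Set.Ioc_subset_Ioc ?_ ?_⟩
  · nlinarith
  · rw [div_le_iff₀ hk']
    exact Nat.floor_le (by positivity)
  · rw [le_div_iff₀ hk']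
    have := Nat.lt_floor_add_one (l * k)
    rw [le_div_iff₀ hk'] at h
    linarith

theorem exists_grid_subset_Ioc {l u : ℝ} {k : ℕ} (hk : 0 < k) (hl : 0 ≤ l) (hu : u ≤ 1)
    (h : 3 / k ≤ u - l) :
    ∃ i : ℕ, i + 2 ≤ k ∧ Set.Ioc ((i : ℝ) / k) ((i + 2) / k) ⊆ Set.Ioc l u := by
  have hk' : (0 : ℝ) < k := Nat.cast_pos.2 hk
  rw [div_le_iff₀ hk'] at h
  have h₁ := Nat.ceil_lt_add_one (mul_nonneg hl hk'.le)
  -- The `3` is one unit for rounding `l` up plus two for the cell.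
  have h₂ : (⌈l * k⌉₊ : ℝ) + 2 ≤ u * k := by linarith
  refine ⟨⌈l * k⌉₊, ?_, Set.Ioc_subset_Ioc ?_ ?_⟩
  · have : (⌈l * k⌉₊ : ℝ) + 2 ≤ k := h₂.trans (by nlinarith)
    exact_mod_cast this
  · rw [le_div_iff₀ hk']
    exact Nat.le_ceil _
  · rwa [div_le_iff₀ hk']

/-! ### Concentration of empirical frequencies. -/

/-- The proportion of the values `Z i ω` with `i ∈ s` that lie in `B`. -/
noncomputable def empiricalFreq {Ω : Type*} (Z : ℕ → Ω → ℝ) (s : Finset ℕ) (B : Set ℝ) (ω : Ω) : ℝ :=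
  (∑ i ∈ s, B.indicator 1 (Z i ω)) / (s.card : ℝ)

theorem empiricalFreq_mono {Ω : Type*} (Z : ℕ → Ω → ℝ) (s : Finset ℕ) {B B' : Set ℝ} (h : B ⊆ B')
    (ω : Ω) : empiricalFreq Z s B ω ≤ empiricalFreq Z s B' ω := by
  unfold empiricalFreq
  gcongr
  exact zero_le_one

theorem empiricalFreq_nonneg {Ω : Type*} (Z : ℕ → Ω → ℝ) (s : Finset ℕ) (B : Set ℝ) (ω : Ω) :
    0 ≤ empiricalFreq Z s B ω :=
  div_nonneg (Finset.sum_nonneg fun _ _ => Set.indicator_nonneg (fun _ _ => zero_le_one) _)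
    (Nat.cast_nonneg _)

theorem empiricalFreq_le_one {Ω : Type*} (Z : ℕ → Ω → ℝ) (s : Finset ℕ) (B : Set ℝ) (ω : Ω) :
    empiricalFreq Z s B ω ≤ 1 := by
  refine div_le_one_of_le₀ ?_ (Nat.cast_nonneg _)
  rw [← nsmul_one, ← Finset.sum_const]
  exact Finset.sum_le_sum fun i _ => Set.indicator_le_self' (fun _ _ => zero_le_one) _

theorem measurable_empiricalFreq {Ω : Type*} [MeasurableSpace Ω] {Z : ℕ → Ω → ℝ}
    (hZ : ∀ i, Measurable (Z i)) (s : Finset ℕ) {B : Set ℝ} (hB : MeasurableSet B) :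
    Measurable (empiricalFreq Z s B) := by
  refine (Finset.measurable_sum _ fun i _ => ?_).div_const _
  exact (measurable_one.indicator hB).comp (hZ i)

/-- A two-sided Hoeffding bound for empirical frequencies. -/
theorem measureReal_empiricalFreq_ge {Ω : Type*} [MeasurableSpace Ω] {P : Measure Ω}
    [IsProbabilityMeasure P] {Z : ℕ → Ω → ℝ} (hZ : ∀ i, Measurable (Z i)) (hind : iIndepFun Z P)
    (hident : ∀ i, IdentDistrib (Z i) (Z 0) P P) {s : Finset ℕ} (hs : s.Nonempty) {B : Set ℝ}
    (hB : MeasurableSet B) {τ : ℝ} (hτ : 0 ≤ τ) :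
    P.real {ω | τ ≤ |empiricalFreq Z s B ω - P.real (Z 0 ⁻¹' B)|} ≤
      2 * Real.exp (-(2 * τ ^ 2 * s.card)) := by
  set p := P.real (Z 0 ⁻¹' B) with hp
  have hc : (0 : ℝ) < s.card := Nat.cast_pos.2 hs.card_pos
  let φ : ℝ → ℝ := fun z => B.indicator 1 z - p
  have hφ : Measurable φ := (measurable_one.indicator hB).sub_const p
  have hint (i : ℕ) : P[fun ω => B.indicator (1 : ℝ → ℝ) (Z i ω)] = p := by
    have := ((hident i).comp (measurable_one.indicator hB : Measurable (B.indicator (1 : ℝ → ℝ)))).integral_eq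
    simp only [Function.comp_def] at this
    rw [this, hp, ← integral_indicator_one (hZ 0 hB)]
    rfl
  -- Hoeffding's lemma: a centred variable with range in an interval of length `1` has variance
  -- proxy `1/4`.
  have hsub (i : ℕ) : HasSubgaussianMGF (fun ω => φ (Z i ω)) ((‖(1 : ℝ) - 0‖₊ / 2) ^ 2) P := by
    have := hasSubgaussianMGF_of_mem_Icc (μ := P) (a := 0) (b := 1)
      (X := fun ω => B.indicator (1 : ℝ → ℝ) (Z i ω))
      ((measurable_one.indicator hB).comp (hZ i)).aemeasurable
      (ae_of_all _ fun ω => ⟨Set.indicator_nonneg (fun _ _ => zero_le_one) _,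
        Set.indicator_le_self' (fun _ _ => zero_le_one) _⟩)
    rwa [hint i] at this
  have hsum (ω : Ω) : ∑ i ∈ s, φ (Z i ω) = s.card * (empiricalFreq Z s B ω - p) := by
    simp only [φ, empiricalFreq, Finset.sum_sub_distrib, Finset.sum_const, nsmul_eq_mul]
    field_simp
  have hexp : -(s.card * τ) ^ 2 / (2 * ∑ i ∈ s, (((‖(1 : ℝ) - 0‖₊ / 2) ^ 2 : NNReal) : ℝ)) =
      -(2 * τ ^ 2 * s.card) := by
    simp
    field_simp
  have h₁ := HasSubgaussianMGF.measure_sum_ge_le_of_iIndepFun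
    (hind.comp (fun _ => φ) fun _ => hφ) (s := s) (fun i _ => hsub i)
    (mul_nonneg hc.le hτ)
  have h₂ := HasSubgaussianMGF.measure_sum_ge_le_of_iIndepFun
    (hind.comp (fun _ => fun z => -φ z) fun _ => hφ.neg) (s := s) (fun i _ => (hsub i).neg)
    (mul_nonneg hc.le hτ)
  simp only [NNReal.coe_sum, hexp, Function.comp_def, Finset.sum_neg_distrib, hsum] at h₁ h₂
  calc P.real {ω | τ ≤ |empiricalFreq Z s B ω - p|}
      ≤ P.real ({ω | s.card * τ ≤ s.card * (empiricalFreq Z s B ω - p)} ∪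
          {ω | s.card * τ ≤ -(s.card * (empiricalFreq Z s B ω - p))}) := by
        refine measureReal_mono fun ω hω => ?_
        simp only [Set.mem_union, Set.mem_ofPred_eq, ← mul_neg, mul_le_mul_iff_right₀ hc]
        exact le_abs.1 hω
    _ ≤ _ := (measureReal_union_le _ _).trans (by linarith)

/-- The strong law of large numbers for empirical frequencies along index sets of at least linear
size. -/
theorem ae_tendsto_empiricalFreq {Ω : Type*} [MeasurableSpace Ω] {P : Measure Ω}
    [IsProbabilityMeasure P] {Z : ℕ → Ω → ℝ} (hZ : ∀ i, Measurable (Z i)) (hind : iIndepFun Z P)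
    (hident : ∀ i, IdentDistrib (Z i) (Z 0) P P) {s : ℕ → Finset ℕ}
    (hs : (fun n : ℕ => (n : ℝ)) =O[atTop] (fun n => ((s n).card : ℝ))) {B : Set ℝ}
    (hB : MeasurableSet B) :
    ∀ᵐ ω ∂P, Tendsto (fun n => empiricalFreq Z (s n) B ω) atTop (nhds (P.real (Z 0 ⁻¹' B))) := by
  obtain ⟨c, hc, hcs⟩ := hs.exists_pos
  have key (τ : ℝ) (hτ : 0 < τ) :
      ∀ᵐ ω ∂P, ∀ᶠ n in atTop, |empiricalFreq Z (s n) B ω - P.real (Z 0 ⁻¹' B)| < τ := by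
    -- The sets `s n` need not be nested, so running averages are no help. Instead `n ≤ c * (s
    -- n).card` turns the Hoeffding bound into a geometric series, and Borel–Cantelli applies.
    have hsum : Summable fun n =>
        P.real {ω | τ ≤ |empiricalFreq Z (s n) B ω - P.real (Z 0 ⁻¹' B)|} := by
      have hneg : -(2 * τ ^ 2 / c) < 0 := by simp only [neg_lt_zero]; positivity
      refine ((Real.summable_exp_nat_mul_iff.2 hneg).mul_left 2).of_norm_bounded_eventually_nat ?_
      filter_upwards [hcs.bound, eventually_gt_atTop 0] with n hn hn0
      simp only [Real.norm_natCast] at hn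
      have hn0' : (0 : ℝ) < n := Nat.cast_pos.2 hn0
      have hpos : (0 : ℝ) < (s n).card := by
        by_contra! h
        nlinarith
      rw [Real.norm_of_nonneg measureReal_nonneg]
      refine (measureReal_empiricalFreq_ge hZ hind hident
        (Finset.card_pos.1 (Nat.cast_pos.1 hpos)) hB hτ.le).trans ?_
      gcongr
      rw [mul_neg, neg_le_neg_iff, mul_div_assoc', div_le_iff₀ hc]
      nlinarith [sq_nonneg τ, mul_le_mul_of_nonneg_left hn (sq_nonneg τ)]
    have hfin : (∑' n, P {ω | τ ≤ |empiricalFreq Z (s n) B ω - P.real (Z 0 ⁻¹' B)|}) ≠ ⊤ := by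
      convert hsum.tsum_ofReal_ne_top using 3
      exact (ofReal_measureReal (measure_ne_top _ _)).symm
    filter_upwards [ae_eventually_notMem hfin] with ω hω
    filter_upwards [hω] with n hn
    exact not_le.1 hn
  have hall : ∀ᵐ ω ∂P, ∀ m : ℕ, ∀ᶠ n in atTop,
      |empiricalFreq Z (s n) B ω - P.real (Z 0 ⁻¹' B)| < 1 / ((m : ℝ) + 1) :=
    ae_all_iff.2 fun m => key _ Nat.one_div_pos_of_nat
  filter_upwards [hall] with ω hω
  rw [Metric.tendsto_atTop']
  intro e he
  obtain ⟨m, hm⟩ := exists_nat_one_div_lt he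
  obtain ⟨N, hN⟩ := eventually_atTop.1 (hω m)
  exact ⟨N, fun n hn => (hN n hn.le).trans hm⟩

/-! ### Probabilities of intervals along one coordinate. -/

theorem density_interval_bounds {d : ℕ} {f : (Fin d → ℝ) → ℝ} {ε C : ℝ} (hε : 0 ≤ ε)
    (hf : ∀ x ∈ Set.Icc (0 : Fin d → ℝ) 1, ε ≤ f x ∧ f x ≤ C) {μ : Measure (Fin d → ℝ)}
    (hμ : μ = (volume.restrict (Set.Icc 0 1)).withDensity (fun x => ENNReal.ofReal (f x)))
    (j : Fin d) (a b : ℝ) (hab : a ≤ b) :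
    μ.real ((fun x => x j) ⁻¹' Set.Ioc a b) ≤ C * (b - a) ∧
      (0 ≤ a → b ≤ 1 → ε * (b - a) ≤ μ.real ((fun x => x j) ⁻¹' Set.Ioc a b)) := by
  set S : Set (Fin d → ℝ) := (fun x => x j) ⁻¹' Set.Ioc a b with hS
  have hSm : MeasurableSet S := measurable_pi_apply j measurableSet_Ioc
  have hC : 0 ≤ C := hε.trans ((hf 0 ⟨le_rfl, zero_le_one⟩).1.trans (hf 0 ⟨le_rfl, zero_le_one⟩).2)
  have hm : MeasurableSet (S ∩ Set.Icc 0 1) := hSm.inter measurableSet_Icc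
  have hμS : μ S = ∫⁻ x in S ∩ Set.Icc 0 1, ENNReal.ofReal (f x) := by
    rw [hμ, withDensity_apply _ hSm, Measure.restrict_restrict hSm]
  have hvol (A : Set ℝ) :
      volume (Set.univ.pi (Function.update (fun _ : Fin d => Set.Icc (0 : ℝ) 1) j A)) = volume A := by
    rw [volume_pi_pi, Finset.prod_eq_single j]
    · simp
    · intro i _ hij
      simp [hij]
    · simp
  -- No condition `0 ≤ a`, `b ≤ 1` is imposed here: intersecting with the cube only shrinks the
  -- slab, so cells sticking out of `[0, 1]` are covered.
  have hup : volume (S ∩ Set.Icc 0 1) ≤ ENNReal.ofReal (b - a) := by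
    rw [← Real.volume_Ioc, ← hvol]
    refine measure_mono fun x hx i _ => ?_
    rcases eq_or_ne i j with rfl | hij
    · rw [Function.update_self]
      exact hx.1
    · simpa [hij] using ⟨hx.2.1 i, hx.2.2 i⟩
  have hle : μ S ≤ ENNReal.ofReal (C * (b - a)) := by
    rw [hμS, ENNReal.ofReal_mul hC]
    calc _ ≤ ∫⁻ _ in S ∩ Set.Icc 0 1, ENNReal.ofReal C :=
          setLIntegral_mono' hm fun x hx => ENNReal.ofReal_le_ofReal (hf x hx.2).2
      _ = ENNReal.ofReal C * volume (S ∩ Set.Icc 0 1) := setLIntegral_const _ _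
      _ ≤ _ := by gcongr
  refine ⟨ENNReal.toReal_le_of_le_ofReal (mul_nonneg hC (sub_nonneg.2 hab)) hle, fun ha hb => ?_⟩
  have hlow : ENNReal.ofReal (b - a) ≤ volume (S ∩ Set.Icc 0 1) := by
    rw [← Real.volume_Ioc, ← hvol]
    refine measure_mono fun x hx => ?_
    have hxj : x j ∈ Set.Ioc a b := by simpa using hx j trivial
    have hxi (i : Fin d) : x i ∈ Set.Icc (0 : ℝ) 1 := by
      rcases eq_or_ne i j with rfl | hij
      · exact ⟨ha.trans hxj.1.le, hxj.2.trans hb⟩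
      · simpa [hij] using hx i trivial
    exact ⟨hxj, fun i => (hxi i).1, fun i => (hxi i).2⟩
  rw [Measure.real, ← ENNReal.ofReal_le_iff_le_toReal (hle.trans_lt ENNReal.ofReal_lt_top).ne, hμS,
    ENNReal.ofReal_mul hε]
  calc _ ≤ ENNReal.ofReal ε * volume (S ∩ Set.Icc 0 1) := by gcongr
    _ = ∫⁻ _ in S ∩ Set.Icc 0 1, ENNReal.ofReal ε := (setLIntegral_const _ _).symm
    _ ≤ _ := setLIntegral_mono' hm fun x hx => ENNReal.ofReal_le_ofReal (hf x hx.2).1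

/-! ### Transfer of convergence to zero. -/

/-- If on eventually almost sure events smallness of `u` forces smallness of `v`, then convergence of
`u` to `0`, in measure or almost surely, implies that of `v`. -/
theorem tendsto_zero_of_ae_eventually_control {Ω : Type*} [MeasurableSpace Ω] {P : Measure Ω}
    [IsFiniteMeasure P] {u v : ℕ → Ω → ℝ} (hu : ∀ n ω, 0 ≤ u n ω) (hv : ∀ n ω, 0 ≤ v n ω)
    (h : ∀ η : ℝ, 0 < η → ∃ δ : ℝ, 0 < δ ∧ ∃ G : ℕ → Set Ω, (∀ n, MeasurableSet (G n)) ∧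
      (∀ᵐ ω ∂P, ∀ᶠ n in atTop, ω ∈ G n) ∧ ∀ n, ∀ ω ∈ G n, u n ω < δ → v n ω < η) :
    (TendstoInMeasure P u atTop (fun _ => 0) → TendstoInMeasure P v atTop (fun _ => 0)) ∧
      ((∀ᵐ ω ∂P, Tendsto (fun n => u n ω) atTop (nhds 0)) →
        ∀ᵐ ω ∂P, Tendsto (fun n => v n ω) atTop (nhds 0)) := by
  constructor
  · simp only [tendstoInMeasure_iff_dist, Real.dist_0_eq_abs, abs_of_nonneg (hu _ _),
      abs_of_nonneg (hv _ _)]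
    intro hlim η hη
    obtain ⟨δ, hδ, G, hG, hae, hcontrol⟩ := h η hη
    have hGc : Tendsto (fun n => P (G n)ᶜ) atTop (nhds 0) := by
      rw [← measure_empty (μ := P)]
      refine tendsto_measure_of_ae_tendsto_indicator_of_isFiniteMeasure atTop .empty
        (fun n => (hG n).compl) ?_
      filter_upwards [hae] with ω hω
      filter_upwards [hω] with n hn
      simpa using hn
    have hadd := (hlim δ hδ).add hGc
    rw [add_zero] at hadd
    -- Only monotonicity and subadditivity of the outer measure are used, so `u` and `v`, later
    -- suprema over uncountably many points, need not be measurable.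
    refine tendsto_of_tendsto_of_tendsto_of_le_of_le tendsto_const_nhds hadd (fun _ => zero_le)
      fun n => (measure_mono fun ω hω => ?_).trans (measure_union_le _ _)
    by_contra hnot
    simp only [Set.mem_union, Set.mem_ofPred_eq, Set.mem_compl_iff, not_or, not_not, not_le] at hnot
    exact (hcontrol n ω hnot.2 hnot.1).not_ge hω
  · intro hlim
    choose! δ hδ G hG hae hcontrol using h
    -- Countably many tolerances `1/(m+1)` allow a single null set.
    have hall : ∀ᵐ ω ∂P, ∀ m : ℕ, ∀ᶠ n in atTop, ω ∈ G (1 / ((m : ℝ) + 1)) n :=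
      ae_all_iff.2 fun m => hae _ Nat.one_div_pos_of_nat
    filter_upwards [hlim, hall] with ω hω hGω
    rw [Metric.tendsto_atTop']
    intro e he
    obtain ⟨m, hm⟩ := exists_nat_one_div_lt he
    have hm0 : (0 : ℝ) < 1 / ((m : ℝ) + 1) := Nat.one_div_pos_of_nat
    obtain ⟨N, hN⟩ := eventually_atTop.1 ((hGω m).and (hω.eventually_lt_const (hδ _ hm0)))
    refine ⟨N, fun n hn => ?_⟩
    rw [Real.dist_0_eq_abs, abs_of_nonneg (hv _ _)]
    exact (hcontrol _ hm0 n ω (hN n hn.le).1 (hN n hn.le).2).trans hm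

theorem IsIIDSample.iIndepFun_coord {Ω : Type*} [MeasurableSpace Ω] {P : Measure Ω} {d : ℕ}
    {X : ℕ → Ω → Fin d → ℝ} {Y : ℕ → Ω → ℝ} (h : IsIIDSample P X Y) (j : Fin d) :
    iIndepFun (fun i ω => X i ω j) P :=
  h.indep.comp (fun _ z => z.1 j) fun _ => (measurable_pi_apply j).comp measurable_fst

theorem IsIIDSample.identDistrib_coord {Ω : Type*} [MeasurableSpace Ω] {P : Measure Ω} {d : ℕ}
    {X : ℕ → Ω → Fin d → ℝ} {Y : ℕ → Ω → ℝ} (h : IsIIDSample P X Y) (j : Fin d) (i : ℕ) :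
    IdentDistrib (fun ω => X i ω j) (fun ω => X 0 ω j) P P :=
  (h.ident i).comp (u := fun z : (Fin d → ℝ) × ℝ => z.1 j)
    ((measurable_pi_apply j).comp measurable_fst)

theorem CovariateAssumption.coord_interval_bounds {Ω : Type*} [MeasurableSpace Ω] {P : Measure Ω}
    {d : ℕ} {X : Ω → Fin d → ℝ} {Y : Ω → ℝ} (h : CovariateAssumption P X Y) (hX : Measurable X) :
    ∃ ε C : ℝ, 0 < ε ∧ 0 < C ∧ ∀ (j : Fin d) (a b : ℝ), a ≤ b →
      P.real ((fun ω => X ω j) ⁻¹' Set.Ioc a b) ≤ C * (b - a) ∧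
      (0 ≤ a → b ≤ 1 → ε * (b - a) ≤ P.real ((fun ω => X ω j) ⁻¹' Set.Ioc a b)) := by
  obtain ⟨f, -, ⟨ε, C, hε, hf⟩, hmap⟩ := h.density
  have h0 := hf 0 ⟨le_rfl, zero_le_one⟩
  refine ⟨ε, C, hε, hε.trans_le (h0.1.trans h0.2), fun j a b hab => ?_⟩
  have := density_interval_bounds hε.le hf hmap j a b hab
  rwa [map_measureReal_apply hX (measurable_pi_apply j measurableSet_Ioc)] at this

/-! ### Side lengths and proportions on the grid event. -/

namespace HonestTree

variable {d : ℕ} {Par Ω : Type*} (T : HonestTree d Par) (θ : Ω → Par) (X : ℕ → Ω → Fin d → ℝ)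
  (Y : ℕ → Ω → ℝ) (j : Fin d) (n : ℕ) (ω : Ω)

theorem bounds (x : Fin d → ℝ) :
    0 ≤ (T.tree θ X Y n ω).lower x j ∧
      (T.tree θ X Y n ω).lower x j ≤ (T.tree θ X Y n ω).upper x j ∧
      (T.tree θ X Y n ω).upper x j ≤ 1 :=
  SplitTree.leafBounds_mem _ 0 1 x zero_le_one (T.valid _ _ _) j

theorem side_le_supSide (x : Set.Icc (0 : Fin d → ℝ) 1) :
    (T.tree θ X Y n ω).upper x j - (T.tree θ X Y n ω).lower x j ≤ T.supSide θ X Y j n ω := by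
  -- An upper bound, here `1`, is needed because an unbounded real supremum defaults to `0`.
  refine le_ciSup (f := fun x : Set.Icc (0 : Fin d → ℝ) 1 =>
    (T.tree θ X Y n ω).upper x j - (T.tree θ X Y n ω).lower x j) ⟨1, ?_⟩ x
  rintro _ ⟨y, rfl⟩
  have := T.bounds θ X Y j n ω y
  dsimp only
  linarith

theorem supSide_nonneg : 0 ≤ T.supSide θ X Y j n ω :=
  Real.iSup_nonneg fun x => sub_nonneg.2 (T.bounds θ X Y j n ω x).2.1

theorem supSide_le {r : ℝ} (h : ∀ x ∈ Set.Icc (0 : Fin d → ℝ) 1,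
    (T.tree θ X Y n ω).upper x j - (T.tree θ X Y n ω).lower x j ≤ r) :
    T.supSide θ X Y j n ω ≤ r :=
  have : Nonempty (Set.Icc (0 : Fin d → ℝ) 1) := ⟨⟨0, le_rfl, zero_le_one⟩⟩
  ciSup_le fun x => h x x.2

/-- Multiplication by a nonnegative constant commutes with the supremum. If `I n` is empty, both
sides are `0` since division by zero gives `0`. -/
theorem supProportion_eq : T.supProportion θ X Y j n ω =
    ⨆ x : Set.Icc (0 : Fin d → ℝ) 1, empiricalFreq (fun i ω => X i ω j) (T.I n)
      (Set.Ioc ((T.tree θ X Y n ω).lower x j) ((T.tree θ X Y n ω).upper x j)) ω := by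
  simp only [supProportion, div_eq_mul_inv,
    Real.iSup_mul_of_nonneg (inv_nonneg.2 (Nat.cast_nonneg (T.I n).card)), count,
    empiricalFreq]

theorem empiricalFreq_le_supProportion (x : Set.Icc (0 : Fin d → ℝ) 1) :
    empiricalFreq (fun i ω => X i ω j) (T.I n)
      (Set.Ioc ((T.tree θ X Y n ω).lower x j) ((T.tree θ X Y n ω).upper x j)) ω ≤
      T.supProportion θ X Y j n ω := by
  rw [supProportion_eq]
  refine le_ciSup (f := fun x : Set.Icc (0 : Fin d → ℝ) 1 =>
    empiricalFreq (fun i ω => X i ω j) (T.I n)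
      (Set.Ioc ((T.tree θ X Y n ω).lower x j) ((T.tree θ X Y n ω).upper x j)) ω) ⟨1, ?_⟩ x
  rintro _ ⟨y, rfl⟩
  exact empiricalFreq_le_one _ _ _ _

theorem supProportion_nonneg : 0 ≤ T.supProportion θ X Y j n ω := by
  rw [supProportion_eq]
  exact Real.iSup_nonneg fun x => empiricalFreq_nonneg _ _ _ _

theorem supProportion_le {r : ℝ} (h : ∀ x ∈ Set.Icc (0 : Fin d → ℝ) 1,
    empiricalFreq (fun i ω => X i ω j) (T.I n)
      (Set.Ioc ((T.tree θ X Y n ω).lower x j) ((T.tree θ X Y n ω).upper x j)) ω ≤ r) :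
    T.supProportion θ X Y j n ω ≤ r := by
  have : Nonempty (Set.Icc (0 : Fin d → ℝ) 1) := ⟨⟨0, le_rfl, zero_le_one⟩⟩
  rw [supProportion_eq]
  exact ciSup_le fun x => h x x.2

/-- The event that the empirical frequencies of the intervals `(i / k, (i + 2) / k]`, `i ≤ k`, along
coordinate `j` are within `τ` of their probabilities. -/
def gridEvent [MeasurableSpace Ω] (P : Measure Ω) (k : ℕ) (τ : ℝ) : Set Ω :=
  {ω | ∀ i ≤ k, |empiricalFreq (fun i ω => X i ω j) (T.I n) (Set.Ioc ((i : ℝ) / k) ((i + 2) / k)) ω -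
    P.real ((fun ω => X 0 ω j) ⁻¹' Set.Ioc ((i : ℝ) / k) ((i + 2) / k))| < τ}

variable {X Y} [MeasurableSpace Ω] {P : Measure Ω}

theorem measurableSet_gridEvent (hX : ∀ i, Measurable (X i)) (k : ℕ) (τ : ℝ) :
    MeasurableSet (T.gridEvent X j n P k τ) := by
  simp only [gridEvent, Set.ofPred_forall]
  refine .iInter fun i => .iInter fun _ => measurableSet_lt (Measurable.abs ?_) measurable_const
  exact (measurable_empiricalFreq (fun i => (measurable_pi_apply j).comp (hX i)) _
    measurableSet_Ioc).sub_const _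

theorem ae_eventually_mem_gridEvent [IsProbabilityMeasure P] (hiid : IsIIDSample P X Y) (k : ℕ)
    {τ : ℝ} (hτ : 0 < τ) : ∀ᵐ ω ∂P, ∀ᶠ n in atTop, ω ∈ T.gridEvent X j n P k τ := by
  have h (i : ℕ) := ae_tendsto_empiricalFreq
    (fun i => (measurable_pi_apply j).comp (hiid.measurable_X i)) (hiid.iIndepFun_coord j)
    (hiid.identDistrib_coord j) T.card_I.2
    (measurableSet_Ioc : MeasurableSet (Set.Ioc ((i : ℝ) / k) ((i + 2) / k)))
  filter_upwards [ae_all_iff.2 h] with ω hω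
  -- For fixed `k` there are finitely many cells, so pointwise convergence is uniform over them.
  refine (eventually_all_finite (Set.finite_Iic k)).2 fun i _ => ?_
  filter_upwards [Metric.tendsto_nhds.1 (hω i) τ hτ] with n hn
  rwa [Real.dist_eq] at hn

/-- Each leaf interval lies in a cell, whose frequency is at most its probability, itself at most
`2C/k`, plus `τ`. -/
theorem supProportion_le_of_supSide_lt {C τ : ℝ} (hC : ∀ (a b : ℝ), a ≤ b →
      P.real ((fun ω => X 0 ω j) ⁻¹' Set.Ioc a b) ≤ C * (b - a)) {k : ℕ} (hk : 0 < k)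
    (hω : ω ∈ T.gridEvent X j n P k τ) (hside : T.supSide θ X Y j n ω < 1 / k) :
    T.supProportion θ X Y j n ω ≤ 2 * C / k + τ := by
  refine T.supProportion_le θ X Y j n ω fun x hx => ?_
  obtain ⟨hl, hlu, hu⟩ := T.bounds θ X Y j n ω x
  obtain ⟨i, hik, hsub⟩ := exists_Ioc_subset_grid hk hl hlu hu
    ((T.side_le_supSide θ X Y j n ω ⟨x, hx⟩).trans hside.le)
  have h₁ := (abs_lt.1 (hω i hik)).2
  have h₂ := hC ((i : ℝ) / k) ((i + 2) / k) (by gcongr; linarith)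
  have h₃ : C * (((i : ℝ) + 2) / k - i / k) = 2 * C / k := by ring
  linarith [empiricalFreq_mono (fun i ω => X i ω j) (T.I n) hsub ω]

/-- A leaf interval longer than `3/k` would contain a cell inside `[0, 1]`, whose frequency exceeds
`2ε/k - τ`. -/
theorem supSide_le_of_supProportion_lt {ε τ : ℝ} (hε : ∀ (a b : ℝ), a ≤ b → 0 ≤ a → b ≤ 1 →
      ε * (b - a) ≤ P.real ((fun ω => X 0 ω j) ⁻¹' Set.Ioc a b)) {k : ℕ} (hk : 0 < k)
    (hω : ω ∈ T.gridEvent X j n P k τ)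
    (hprop : T.supProportion θ X Y j n ω < 2 * ε / k - τ) :
    T.supSide θ X Y j n ω ≤ 3 / k := by
  have hk' : (0 : ℝ) < k := Nat.cast_pos.2 hk
  refine T.supSide_le θ X Y j n ω fun x hx => ?_
  by_contra! hlt
  obtain ⟨hl, -, hu⟩ := T.bounds θ X Y j n ω x
  obtain ⟨i, hik, hsub⟩ := exists_grid_subset_Ioc hk hl hu hlt.le
  have h₁ := (abs_lt.1 (hω i (by lia))).1
  have h₂ := hε ((i : ℝ) / k) ((i + 2) / k) (by gcongr; linarith) (by positivity)
    (by rw [div_le_one hk']; exact_mod_cast hik)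
  have h₃ : ε * (((i : ℝ) + 2) / k - i / k) = 2 * ε / k := by ring
  linarith [empiricalFreq_mono (fun i ω => X i ω j) (T.I n) hsub ω,
    T.empiricalFreq_le_supProportion θ X Y j n ω ⟨x, hx⟩]

end HonestTree

theorem mainTheorem6 {Ω : Type*} [MeasurableSpace Ω] (P : Measure Ω) [IsProbabilityMeasure P]
    {d : ℕ} {Par : Type*} [MeasurableSpace Par]
    (X : ℕ → Ω → Fin d → ℝ) (Y : ℕ → Ω → ℝ) (θ : Ω → Par)
    (hiid : IsIIDSample P X Y)
    (hcov : CovariateAssumption P (X 0) (Y 0))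
    (hθ : Measurable θ)
    (hindep : IndepFun θ (fun ω (i : ℕ) => (X i ω, Y i ω)) P)
    (T : HonestTree d Par) :
    ((∀ j : Fin d, TendstoInMeasure P (fun n => T.supSide θ X Y j n) atTop (fun _ => 0)) ↔
      (∀ j : Fin d, TendstoInMeasure P (fun n => T.supProportion θ X Y j n) atTop (fun _ => 0))) ∧
    ((∀ j : Fin d, ∀ᵐ ω ∂P, Tendsto (fun n => T.supSide θ X Y j n ω) atTop (nhds 0)) ↔
      (∀ j : Fin d, ∀ᵐ ω ∂P, Tendsto (fun n => T.supProportion θ X Y j n ω) atTop (nhds 0))) := by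
  obtain ⟨ε, C, hε, hC, hbd⟩ := hcov.coord_interval_bounds (hiid.measurable_X 0)
  have hforward (j : Fin d) := tendsto_zero_of_ae_eventually_control (P := P)
    (u := fun n ω => T.supSide θ X Y j n ω) (v := fun n ω => T.supProportion θ X Y j n ω)
    (T.supSide_nonneg θ X Y j) (T.supProportion_nonneg θ X Y j) fun η hη => by
      -- This gives `2C/k < η/2`; with `τ = η/3` the total stays below `η`.
      obtain ⟨k, hk⟩ := exists_nat_gt (4 * C / η)
      have hk' : (0 : ℝ) < k := lt_trans (by positivity) hk
      refine ⟨1 / k, by positivity, fun n => T.gridEvent X j n P k (η / 3),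
        fun n => T.measurableSet_gridEvent j n hiid.measurable_X k _,
        T.ae_eventually_mem_gridEvent j hiid k (by positivity), fun n ω hω hlt => ?_⟩
      have h₁ := T.supProportion_le_of_supSide_lt θ j n ω (fun a b hab => (hbd j a b hab).1)
        (Nat.cast_pos.1 hk') hω hlt
      have h₂ : 2 * C / k < η / 2 := by
        rw [div_lt_iff₀ hη] at hk
        rw [div_lt_iff₀ hk']
        linarith
      linarith
  have hbackward (j : Fin d) := tendsto_zero_of_ae_eventually_control (P := P)
    (u := fun n ω => T.supProportion θ X Y j n ω) (v := fun n ω => T.supSide θ X Y j n ω)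
    (T.supProportion_nonneg θ X Y j) (T.supSide_nonneg θ X Y j) fun η hη => by
      obtain ⟨k, hk⟩ := exists_nat_gt (3 / η)
      have hk' : (0 : ℝ) < k := lt_trans (by positivity) hk
      -- With `τ = ε/k` the required threshold `2ε/k - τ` is exactly `δ = ε/k`.
      refine ⟨ε / k, by positivity, fun n => T.gridEvent X j n P k (ε / k),
        fun n => T.measurableSet_gridEvent j n hiid.measurable_X k _,
        T.ae_eventually_mem_gridEvent j hiid k (by positivity), fun n ω hω hlt => ?_⟩
      refine (T.supSide_le_of_supProportion_lt θ j n ω (fun a b hab => (hbd j a b hab).2)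
        (Nat.cast_pos.1 hk') hω (hlt.trans_eq (by ring))).trans_lt ?_
      rw [div_lt_iff₀ hη] at hk
      rw [div_lt_iff₀ hk']
      linarith
  exact ⟨⟨fun h j => (hforward j).1 (h j), fun h j => (hbackward j).1 (h j)⟩,
    ⟨fun h j => (hforward j).2 (h j), fun h j => (hbackward j).2 (h j)⟩⟩
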